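/- Let $s=(s_i)_{i\in\mathbb{N}_0}$ be a real sequence. Let $L_s:\mathbb{R}[x]\to\mathbb{R}$ be the linear functional with $L_s(x^i)=s_i$ for all $i$, and let $\partial s$ be the sequence $(\partial s)_i := -L_s\big((x^i)'\big)$, i.e. $(\partial s)_0=0$ and $(\partial s)_i=-i\,s_{i-1}$ for $i\ge 1$. Call $f:[0,1]\to\mathbb{R}$ *piecewise continuous* if its (finite) one-sided limits exist at every point of $[0,1]$ and it has at most countably many points of discontinuity. Then the following are equivalent: (i) There exists a piecewise continuous function $f:[0,1]\to\mathbb{R}$ such that $s_i=\int_0^1 x^i f(x)\,\mathrm{d}x$ for all $i\in\mathbb{N}_0$, and the distributional derivative $f'$ on $\mathbb{R}$ of $f$ (extended by $0$ outside $[0,1]$) is a regular signed measure on $[0,1]$; that is, there are finite regular Borel measures $\mu_1,\mu_2$ on $[0,1]$ with $\int_0^1 f\varphi'\,\mathrm{d}x=-\int\varphi\,\mathrm{d}(\mu_1-\mu_2)$ for all $\varphi\in C_c^\infty(\mathbb{R})$. (ii) There exists a constant $C>0$ such that $$\sum_{k=0}^d\binom{d}{k}\,\big|L_s\big(x^k(1-x)^{d-k}\big)\big|<C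 \quad\text{and}\quad \sum_{k=0}^d\binom{d}{k}\,\big|L_{\partial s}\big(x^k(1-x)^{d-k}\big)\big|<C$$ for all $d\in\mathbb{N}_0$. If these hold and additionally $L_s\big(x^k(1-x)^l\big)\ge 0$ for all $k,l\in\mathbb{N}_0$, then every $f$ as in (i) satisfies $f(x)\ge 0$ at each of its points of continuity $x\in[0,1]$ (hence at all but countably many points of $[0,1]$), and $f$ in (i) can be chosen with $f\ge 0$ on all of $[0,1]$. -/

import Mathlib

open MeasureTheory Polynomial Set Filter Topology
open scoped ContDiff

/-- The Riesz functional `L_s : ℝ[x] → ℝ` of a real sequence `s`: the linear map with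
`L_s (x ^ i) = s i` for all `i`. -/
noncomputable def rieszFunctional (s : ℕ → ℝ) : ℝ[X] →ₗ[ℝ] ℝ :=
  (Polynomial.basisMonomials ℝ).constr ℝ s

theorem rieszFunctional_X_pow (s : ℕ → ℝ) (i : ℕ) : rieszFunctional s (X ^ i) = s i := by
  have h := (Polynomial.basisMonomials ℝ).constr_basis ℝ s i
  rw [Polynomial.coe_basisMonomials] at h
  rw [← Polynomial.monomial_one_right_eq_X_pow]
  exact h

/-- The derivative `∂s` of a real sequence `s`, `(∂s) i = - L_s ((x ^ i)')`; that is,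
`(∂s) 0 = 0` and `(∂s) i = - i * s (i - 1)` for `1 ≤ i`. -/
noncomputable def momentDeriv (s : ℕ → ℝ) (i : ℕ) : ℝ :=
  - rieszFunctional s (derivative (X ^ i))

theorem momentDeriv_zero (s : ℕ → ℝ) : momentDeriv s 0 = 0 := by
  simp [momentDeriv]

theorem momentDeriv_succ (s : ℕ → ℝ) (i : ℕ) : momentDeriv s (i + 1) = -((i + 1) * s i) := by
  rw [momentDeriv, derivative_X_pow, ← smul_eq_C_mul, map_smul]
  simp [rieszFunctional_X_pow]

/-- Piecewise continuity of `f` on `[0,1]` in the sense in which distribution functions of finite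
signed measures are piecewise continuous: all one-sided limits exist (as real numbers), and `f`
has at most countably many points of discontinuity in `[0,1]` (which are therefore jumps or
removable). Only the values of `f` on `[0,1]` matter. Such an `f` is bounded on `[0,1]` and
integrable there. -/
structure PiecewiseContinuousOnUnit (f : ℝ → ℝ) : Prop where
  right_limit : ∀ x ∈ Ico (0 : ℝ) 1, ∃ l : ℝ, Tendsto f (𝓝[>] x) (𝓝 l)
  left_limit : ∀ x ∈ Ioc (0 : ℝ) 1, ∃ l : ℝ, Tendsto f (𝓝[<] x) (𝓝 l)
  countable_discontinuities :
    {x ∈ Icc (0 : ℝ) 1 | ¬ ContinuousWithinAt f (Icc 0 1) x}.Countable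

/-- The distributional derivative of `f : [0,1] → ℝ` (extended by zero to a function on `ℝ`, so
that point masses at `0` and `1` are part of the derivative) is a regular signed measure
`μ₁ - μ₂` on `[0,1]`: for every test function `φ` on `ℝ`, `∫ f φ' = - ∫ φ d(μ₁ - μ₂)`. -/
def DistribDerivIsSignedMeasure (f : ℝ → ℝ) : Prop :=
  ∃ μ₁ μ₂ : Measure (Icc (0 : ℝ) 1), IsFiniteMeasure μ₁ ∧ IsFiniteMeasure μ₂ ∧
    μ₁.Regular ∧ μ₂.Regular ∧
    ∀ φ : ℝ → ℝ, ContDiff ℝ ∞ φ → HasCompactSupport φ →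
      ∫ x in (0 : ℝ)..1, f x * deriv φ x = -(∫ x, φ x ∂μ₁ - ∫ x, φ x ∂μ₂)

/-- `f` is a piecewise continuous density on `[0,1]` with moment sequence `s`, whose distributional
derivative is a regular signed measure on `[0,1]`. -/
structure IsRepresentingDensity (s : ℕ → ℝ) (f : ℝ → ℝ) : Prop where
  piecewise_continuous : PiecewiseContinuousOnUnit f
  moment : ∀ i : ℕ, s i = ∫ x in (0 : ℝ)..1, x ^ i * f x
  deriv_measure : DistribDerivIsSignedMeasure f

/-!
By Hausdorff's theorem a linear functional `L` on `ℝ[X]` is integration against a finite signed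
measure on `[0,1]` iff the sums `∑ k, |L (b_{n,k})|` over the Bernstein basis are bounded in `n`.
Such a bound makes the maps `g ↦ L (B_n g)` uniformly bounded on `C([0,1])`, whence
`L (B_n p) → L p` for polynomials `p`, and `L (B_n p)` is the integral of `p` against the atomic
signed measure `∑ k, L (b_{n,k}) δ_{k/n}`; a limit of the positive and negative parts of these
along an ultrafilter represents `L`.

If `s` has density `f`, then `L_∂s` is integration against `f'`, so both bounds follow.
Conversely, the bound for `L_∂s` alone gives `L_∂s = μ - ν`; since `(∂s)_0 = 0` the two masses
agree, and integration by parts shows that `f x = μ [0,x) - ν [0,x)` is a density for `s`.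

Positivity of `L_s` on the Bernstein basis passes to the limit `∫ g f = lim L_s (B_n g) ≥ 0` for
every continuous `g ≥ 0`, so `f` cannot be negative at a point of continuity, and the countably
many other values of `f` may be replaced by their positive parts.
-/

open scoped unitInterval BoundedContinuousFunction

theorem add_one_mul_bernsteinPolynomial_succ (R : Type*) [CommRing R] (n k : ℕ) :
    ((k + 1 : ℕ) : R[X]) * bernsteinPolynomial R (n + 1) (k + 1) =
      ((n + 1 : ℕ) : R[X]) * X * bernsteinPolynomial R n k := by
  have h : (((n + 1) * n.choose k : ℕ) : R[X]) = ((n + 1).choose (k + 1) * (k + 1) : ℕ) := by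
    rw [Nat.add_one_mul_choose_eq]
  push_cast at h
  simp only [bernsteinPolynomial, Nat.add_sub_add_right, pow_succ]
  push_cast
  linear_combination -(X ^ k * X * (1 - X) ^ (n - k)) * h

theorem sum_descFactorial_mul_bernsteinPolynomial (R : Type*) [CommRing R] (n m : ℕ) :
    ∑ k ∈ Finset.range (n + 1), (k.descFactorial m : R[X]) * bernsteinPolynomial R n k =
      (n.descFactorial m : R[X]) * X ^ m := by
  induction m generalizing n with
  | zero => simpa using bernsteinPolynomial.sum R n
  | succ m ih =>
    cases n with
    | zero => simp
    | succ n =>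
      calc _ = ∑ k ∈ Finset.range (n + 1), ((n + 1 : ℕ) : R[X]) * X *
                ((k.descFactorial m : R[X]) * bernsteinPolynomial R n k) := by
              rw [Finset.sum_range_succ']
              simp only [Nat.succ_descFactorial_succ, Nat.zero_descFactorial_succ, Nat.cast_zero,
                zero_mul, add_zero]
              refine Finset.sum_congr rfl fun k _ => ?_
              rw [Nat.cast_mul, mul_right_comm, add_one_mul_bernsteinPolynomial_succ]
              ring
        _ = _ := by
              rw [← Finset.mul_sum, ih, Nat.succ_descFactorial_succ, Nat.cast_mul]
              ring

/-- The Bernstein operator `B_n g = ∑ k, g (k / n) b_{n,k}`, with values in polynomials so that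
linear functionals on `ℝ[X]` can be applied to it; as functions on `[0,1]` these are Mathlib's
`bernsteinApproximation n g`. -/
noncomputable def bernsteinOperator (n : ℕ) : C(I, ℝ) →ₗ[ℝ] ℝ[X] where
  toFun g := ∑ k : Fin (n + 1), g (bernstein.z k) • bernsteinPolynomial ℝ n k
  map_add' g h := by simp only [ContinuousMap.add_apply, add_smul, Finset.sum_add_distrib]
  map_smul' c g := by
    simp only [ContinuousMap.smul_apply, smul_assoc, Finset.smul_sum, RingHom.id_apply]

theorem bernsteinOperator_apply (n : ℕ) (g : C(I, ℝ)) :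
    bernsteinOperator n g = ∑ k : Fin (n + 1), g (bernstein.z k) • bernsteinPolynomial ℝ n k :=
  rfl

theorem eval_bernsteinOperator (n : ℕ) (g : C(I, ℝ)) (x : I) :
    (bernsteinOperator n g).eval (x : ℝ) = bernsteinApproximation n g x := by
  simp only [bernsteinOperator_apply, eval_finsetSum, eval_smul, bernsteinApproximation.apply,
    smul_eq_mul, mul_comm (g _)]
  rfl

/-- The interpolant `x ↦ (nx)(nx - 1)⋯(nx - m + 1) / (n(n - 1)⋯(n - m + 1))`, whose Bernstein
polynomial of degree `n ≥ m` is exactly `x ^ m`. Its factors `(nx - i) / (n - i)` are written as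
perturbations of `x`, so that convergence to `x ^ m` is visible. -/
noncomputable def descFactorialRatio (n m : ℕ) : C(I, ℝ) :=
  ∏ i ∈ Finset.range m, (X.toContinuousMapOn I +
    ((i : ℝ) / (n - i)) • (X.toContinuousMapOn I - 1))

theorem descFactorialRatio_z {n m : ℕ} (hm : m ≤ n) (k : Fin (n + 1)) :
    descFactorialRatio n m (bernstein.z k) =
      ((k : ℕ).descFactorial m : ℝ) / (n.descFactorial m : ℝ) := by
  simp only [← descPochhammer_eval_eq_descFactorial ℝ, descPochhammer_eval_eq_prod_range,
    ← Finset.prod_div_distrib, descFactorialRatio, ContinuousMap.prod_apply]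
  refine Finset.prod_congr rfl fun i hi => ?_
  have hin : i < n := (Finset.mem_range.1 hi).trans_le hm
  have hn : (n : ℝ) ≠ 0 := by exact_mod_cast (Nat.zero_le i).trans_lt hin |>.ne'
  have hni : (n : ℝ) - i ≠ 0 := sub_ne_zero.2 (by exact_mod_cast hin.ne')
  simp only [bernstein.z, ContinuousMap.add_apply, toContinuousMapOn_apply, toContinuousMap_apply,
    eval_X, ContinuousMap.coe_smul, ContinuousMap.coe_sub, ContinuousMap.coe_one, Pi.smul_apply,
    Pi.sub_apply, Pi.one_apply, smul_eq_mul]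
  field_simp
  ring

theorem bernsteinOperator_descFactorialRatio {n m : ℕ} (hm : m ≤ n) :
    bernsteinOperator n (descFactorialRatio n m) = X ^ m := by
  have hn : (n.descFactorial m : ℝ) ≠ 0 :=
    Nat.cast_ne_zero.2 (Nat.descFactorial_eq_zero_iff_lt.not.2 hm.not_gt)
  have hsum := sum_descFactorial_mul_bernsteinPolynomial ℝ n m
  simp only [Finset.sum_range, ← nsmul_eq_mul, ← Nat.cast_smul_eq_nsmul ℝ] at hsum
  simp only [bernsteinOperator_apply, descFactorialRatio_z hm, div_eq_inv_mul, mul_smul,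
    ← Finset.smul_sum]
  rw [hsum, inv_smul_smul₀ hn]

theorem tendsto_descFactorialRatio (m : ℕ) :
    Tendsto (fun n => descFactorialRatio n m) atTop (𝓝 ((X ^ m : ℝ[X]).toContinuousMapOn I)) := by
  have hX : (X ^ m : ℝ[X]).toContinuousMapOn I =
      ∏ _i ∈ Finset.range m, (X.toContinuousMapOn I + (0 : ℝ) • (X.toContinuousMapOn I - 1)) := by
    ext x
    simp
  rw [hX]
  refine tendsto_finsetProd _ fun i _ => tendsto_const_nhds.add (Tendsto.smul_const ?_ _)
  exact tendsto_const_nhds.div_atTop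
    (tendsto_atTop_add_const_right _ _ tendsto_natCast_atTop_atTop)

/-- The `d`-th total variation `∑ k, |L (b_{d,k})|` of a linear functional on polynomials, where
`b_{d,k} = (d choose k) x ^ k (1 - x) ^ (d - k)`. -/
noncomputable def bernsteinVariation (L : ℝ[X] →ₗ[ℝ] ℝ) (d : ℕ) : ℝ :=
  ∑ k : Fin (d + 1), |L (bernsteinPolynomial ℝ d k)|

theorem bernsteinVariation_eq (L : ℝ[X] →ₗ[ℝ] ℝ) (d : ℕ) :
    bernsteinVariation L d = ∑ k ∈ Finset.range (d + 1),
      (d.choose k : ℝ) * |L (X ^ k * (1 - X) ^ (d - k))| := by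
  rw [Finset.sum_range]
  refine Finset.sum_congr rfl fun k _ => ?_
  rw [bernsteinPolynomial, mul_assoc, ← nsmul_eq_mul, map_nsmul, nsmul_eq_mul, abs_mul,
    Nat.abs_cast]

theorem map_bernsteinOperator (L : ℝ[X] →ₗ[ℝ] ℝ) (n : ℕ) (g : C(I, ℝ)) :
    L (bernsteinOperator n g) =
      ∑ k : Fin (n + 1), L (bernsteinPolynomial ℝ n k) * g (bernstein.z k) := by
  simp only [bernsteinOperator_apply, map_sum, map_smul, smul_eq_mul, mul_comm (g _)]

theorem abs_map_bernsteinOperator_le (L : ℝ[X] →ₗ[ℝ] ℝ) (n : ℕ) (g : C(I, ℝ)) :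
    |L (bernsteinOperator n g)| ≤ bernsteinVariation L n * ‖g‖ := by
  rw [map_bernsteinOperator, bernsteinVariation, Finset.sum_mul]
  refine (Finset.abs_sum_le_sum_abs _ _).trans (Finset.sum_le_sum fun k _ => ?_)
  rw [abs_mul]
  exact mul_le_mul_of_nonneg_left (g.norm_coe_le_norm _) (abs_nonneg _)

theorem tendsto_map_bernsteinOperator_X_pow {L : ℝ[X] →ₗ[ℝ] ℝ}
    (hL : BddAbove (range (bernsteinVariation L))) (m : ℕ) :
    Tendsto (fun n => L (bernsteinOperator n ((X ^ m : ℝ[X]).toContinuousMapOn I))) atTop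
      (𝓝 (L (X ^ m))) := by
  obtain ⟨C, hC⟩ := hL
  set g := (X ^ m : ℝ[X]).toContinuousMapOn I
  have hlim : Tendsto (fun n => C * ‖g - descFactorialRatio n m‖) atTop (𝓝 0) := by
    simpa only [g, sub_self, norm_zero, mul_zero] using
      ((tendsto_descFactorialRatio m).const_sub g).norm.const_mul C
  -- `x ^ m = B_n (descFactorialRatio n m)`, and the maps `L ∘ B_n` are uniformly bounded.
  rw [tendsto_iff_norm_sub_tendsto_zero]
  refine squeeze_zero' (Eventually.of_forall fun _ => norm_nonneg _) ?_ hlim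
  filter_upwards [eventually_ge_atTop m] with n hn
  rw [← bernsteinOperator_descFactorialRatio hn, ← map_sub, ← map_sub]
  exact (abs_map_bernsteinOperator_le L n _).trans
    (mul_le_mul_of_nonneg_right (hC (mem_range_self n)) (norm_nonneg _))

theorem tendsto_map_bernsteinOperator {L : ℝ[X] →ₗ[ℝ] ℝ}
    (hL : BddAbove (range (bernsteinVariation L))) (p : ℝ[X]) :
    Tendsto (fun n => L (bernsteinOperator n (p.toContinuousMapOn I))) atTop (𝓝 (L p)) := by
  induction p using Polynomial.induction_on' with
  | add p q hp hq =>
    have h : (p + q).toContinuousMapOn I = p.toContinuousMapOn I + q.toContinuousMapOn I := by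
      ext; simp
    simpa only [h, map_add] using hp.add hq
  | monomial m a =>
    have h : (a • X ^ m : ℝ[X]).toContinuousMapOn I = a • (X ^ m : ℝ[X]).toContinuousMapOn I := by
      ext; simp
    simpa only [← C_mul_X_pow_eq_monomial, ← smul_eq_C_mul, h, map_smul] using
      (tendsto_map_bernsteinOperator_X_pow hL m).const_smul a

section WeightedDirac

variable {ι E : Type*} [Fintype ι] [MeasurableSpace E]

/-- The measure `∑ i, (c i)⁺ δ_{z i}`, so that `weightedDirac c z - weightedDirac (-c) z` is the
signed measure `∑ i, c i δ_{z i}`. -/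
noncomputable def weightedDirac (c : ι → ℝ) (z : ι → E) : FiniteMeasure E :=
  ∑ i, (c i).toNNReal • ⟨Measure.dirac (z i), inferInstance⟩

theorem toMeasure_weightedDirac (c : ι → ℝ) (z : ι → E) :
    (weightedDirac c z : Measure E) = ∑ i, (c i).toNNReal • Measure.dirac (z i) := by
  rw [weightedDirac, FiniteMeasure.toMeasure_sum]
  rfl

theorem mass_weightedDirac_le (c : ι → ℝ) (z : ι → E) :
    ((weightedDirac c z).mass : ℝ) ≤ ∑ i, |c i| := by
  have h : (weightedDirac c z).mass = ∑ i, (c i).toNNReal := by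
    rw [← ENNReal.coe_inj, FiniteMeasure.ennreal_mass, toMeasure_weightedDirac]
    simp
  rw [h, NNReal.coe_sum]
  refine Finset.sum_le_sum fun i _ => ?_
  rw [Real.coe_toNNReal']
  exact max_le (le_abs_self _) (abs_nonneg _)

theorem integral_weightedDirac [MeasurableSingletonClass E] (c : ι → ℝ) (z : ι → E)
    (g : E → ℝ) :
    ∫ x, g x ∂(weightedDirac c z : Measure E) = ∑ i, max (c i) 0 * g (z i) := by
  rw [toMeasure_weightedDirac, integral_finsetSum_measure fun i _ =>
    (integrable_dirac enorm_lt_top).smul_measure_nnreal]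
  simp only [integral_smul_nnreal_measure, integral_dirac, NNReal.smul_def, Real.coe_toNNReal',
    smul_eq_mul]

theorem integral_weightedDirac_sub_neg [MeasurableSingletonClass E] (c : ι → ℝ) (z : ι → E)
    (g : E → ℝ) :
    ∫ x, g x ∂(weightedDirac c z : Measure E) - ∫ x, g x ∂(weightedDirac (-c) z : Measure E) =
      ∑ i, c i * g (z i) := by
  simp only [integral_weightedDirac, ← Finset.sum_sub_distrib, ← sub_mul, Pi.neg_apply,
    max_zero_sub_max_neg_zero_eq_self]

end WeightedDirac

theorem exists_finiteMeasure_tendsto_of_mass_le {ι E : Type*} [MeasurableSpace E]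
    [TopologicalSpace E] [T2Space E] [BorelSpace E] [CompactSpace E] (U : Ultrafilter ι)
    {μ : ι → FiniteMeasure E} {C : ℝ} (hμ : ∀ i, ((μ i).mass : ℝ) ≤ C) :
    ∃ ν : FiniteMeasure E, Tendsto μ U (𝓝 ν) := by
  have hmem : {ρ : FiniteMeasure E | ρ.mass ≤ C.toNNReal} ∈ U.map μ :=
    Ultrafilter.mem_map.2 (univ_mem' fun i => NNReal.le_toNNReal_of_coe_le (hμ i))
  obtain ⟨ν, -, hν⟩ :=
    (isCompact_setOfPred_finiteMeasure_le_of_compactSpace E C.toNNReal).ultrafilter_le_nhds' _ hmem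
  exact ⟨ν, hν⟩

theorem exists_finiteMeasure_sub_of_bddAbove_bernsteinVariation {L : ℝ[X] →ₗ[ℝ] ℝ}
    (hL : BddAbove (range (bernsteinVariation L))) :
    ∃ μ ν : FiniteMeasure I, ∀ p : ℝ[X],
      L p =
        ∫ x : I, p.eval (x : ℝ) ∂(μ : Measure I) - ∫ x : I, p.eval (x : ℝ) ∂(ν : Measure I) := by
  have ⟨C, hC⟩ := hL
  let c (n : ℕ) (k : Fin (n + 1)) : ℝ := L (bernsteinPolynomial ℝ n k)
  have hmass (n : ℕ) : ∑ k, |c n k| ≤ C := hC (mem_range_self n)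
  obtain ⟨μ, hμ⟩ := exists_finiteMeasure_tendsto_of_mass_le (hyperfilter ℕ)
    fun n => (mass_weightedDirac_le (c n) bernstein.z).trans (hmass n)
  obtain ⟨ν, hν⟩ := exists_finiteMeasure_tendsto_of_mass_le (hyperfilter ℕ)
    fun n => (mass_weightedDirac_le (-c n) bernstein.z).trans
      ((Finset.sum_congr rfl fun k _ => abs_neg _).trans_le (hmass n))
  refine ⟨μ, ν, fun p => ?_⟩
  let g : I →ᵇ ℝ := BoundedContinuousFunction.mkOfCompact (p.toContinuousMapOn I)
  rw [FiniteMeasure.tendsto_iff_forall_integral_tendsto] at hμ hν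
  refine tendsto_nhds_unique
    ((tendsto_map_bernsteinOperator hL p).mono_left Nat.hyperfilter_le_atTop)
    (((hμ g).sub (hν g)).congr fun n => ?_)
  rw [integral_weightedDirac_sub_neg, map_bernsteinOperator]
  rfl

theorem sum_abs_integral_bernstein_mul_le {μ : Measure I} {h : I → ℝ} (hh : Integrable h μ)
    (d : ℕ) : ∑ k : Fin (d + 1), |∫ x, bernstein d k x * h x ∂μ| ≤ ∫ x, |h x| ∂μ := by
  have hint (k : Fin (d + 1)) : Integrable (fun x => bernstein d k x * |h x|) μ :=
    hh.abs.bdd_mul (bernstein d k).continuous.aestronglyMeasurable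
      (Eventually.of_forall (bernstein d k).norm_coe_le_norm)
  calc _ ≤ ∑ k : Fin (d + 1), ∫ x, bernstein d k x * |h x| ∂μ := by
        refine Finset.sum_le_sum fun k _ => abs_integral_le_integral_abs.trans_eq ?_
        simp only [abs_mul, abs_of_nonneg bernstein_nonneg]
    _ = ∫ x, (∑ k : Fin (d + 1), bernstein d k x) * |h x| ∂μ := by
        simp only [Finset.sum_mul]
        exact (integral_finsetSum _ fun k _ => hint k).symm
    _ = ∫ x, |h x| ∂μ := by simp only [bernstein.probability, one_mul]

theorem bddAbove_bernsteinVariation_of_density {L : ℝ[X] →ₗ[ℝ] ℝ} {μ : Measure I} {h : I → ℝ}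
    (hh : Integrable h μ) (hL : ∀ p : ℝ[X], L p = ∫ x : I, p.eval (x : ℝ) * h x ∂μ) :
    BddAbove (range (bernsteinVariation L)) := by
  refine ⟨∫ x, |h x| ∂μ, forall_mem_range.2 fun d => ?_⟩
  simp only [bernsteinVariation, hL]
  exact sum_abs_integral_bernstein_mul_le hh d

theorem bddAbove_bernsteinVariation_iff {L : ℝ[X] →ₗ[ℝ] ℝ} :
    BddAbove (range (bernsteinVariation L)) ↔ ∃ μ ν : FiniteMeasure I, ∀ p : ℝ[X],
      L p =
        ∫ x : I, p.eval (x : ℝ) ∂(μ : Measure I) - ∫ x : I, p.eval (x : ℝ) ∂(ν : Measure I) := by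
  refine ⟨exists_finiteMeasure_sub_of_bddAbove_bernsteinVariation, fun ⟨μ, ν, h⟩ => ?_⟩
  have hbound (ρ : FiniteMeasure I) (d : ℕ) :
      ∑ k : Fin (d + 1), |∫ x : I, (bernsteinPolynomial ℝ d k).eval (x : ℝ) ∂(ρ : Measure I)| ≤
        (ρ : Measure I).real univ := by
    have h := sum_abs_integral_bernstein_mul_le (integrable_const (μ := (ρ : Measure I)) (1 : ℝ)) d
    simp only [mul_one, abs_one, integral_const, smul_eq_mul] at h
    exact h
  refine ⟨(μ : Measure I).real univ + (ν : Measure I).real univ, forall_mem_range.2 fun d => ?_⟩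
  refine le_trans ?_ (add_le_add (hbound μ d) (hbound ν d))
  simp only [bernsteinVariation, h, ← Finset.sum_add_distrib]
  exact Finset.sum_le_sum fun k _ => abs_sub _ _

theorem continuous_integral_continuousMap_mul {X : Type*} [TopologicalSpace X] [CompactSpace X]
    [MeasurableSpace X] [OpensMeasurableSpace X] {μ : Measure X} {h : X → ℝ}
    (hh : Integrable h μ) : Continuous fun g : C(X, ℝ) => ∫ x, g x * h x ∂μ := by
  refine continuous_iff_continuousAt.2 fun g =>
    tendsto_integral_filter_of_dominated_convergence (fun x => (‖g‖ + 1) * |h x|) ?_ ?_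
      (hh.abs.const_mul _) ?_
  · exact Eventually.of_forall fun g' =>
      g'.continuous.aestronglyMeasurable.mul hh.aestronglyMeasurable
  · filter_upwards [continuous_norm.continuousAt.eventually_lt_const (lt_add_one ‖g‖)] with g' hg'
    refine Eventually.of_forall fun x => ?_
    rw [norm_mul]
    exact mul_le_mul_of_nonneg_right ((g'.norm_coe_le_norm x).trans hg'.le) (abs_nonneg _)
  · exact Eventually.of_forall fun x =>
      ((continuous_eval_const x).tendsto g).mul_const _

theorem integral_mul_nonneg_of_map_nonneg {L : ℝ[X] →ₗ[ℝ] ℝ} {μ : Measure I} {h : I → ℝ}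
    (hh : Integrable h μ) (hL : ∀ p : ℝ[X], L p = ∫ x : I, p.eval (x : ℝ) * h x ∂μ)
    (hpos : ∀ k l : ℕ, 0 ≤ L (X ^ k * (1 - X) ^ l)) {g : C(I, ℝ)} (hg : 0 ≤ g) :
    0 ≤ ∫ x, g x * h x ∂μ := by
  refine ge_of_tendsto' (((continuous_integral_continuousMap_mul hh).tendsto g).comp
    (bernsteinApproximation_uniform g)) fun n => ?_
  have hn : ∫ x, bernsteinApproximation n g x * h x ∂μ = L (bernsteinOperator n g) := by
    simp only [hL, eval_bernsteinOperator]
  rw [Function.comp_apply, hn, map_bernsteinOperator]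
  refine Finset.sum_nonneg fun k _ => mul_nonneg ?_ (hg _)
  rw [bernsteinPolynomial, mul_assoc, ← nsmul_eq_mul, map_nsmul]
  exact nsmul_nonneg (hpos _ _) _

theorem nonneg_of_continuousAt_of_integral_mul_nonneg {X : Type*} [PseudoMetricSpace X]
    [CompactSpace X] [MeasurableSpace X] [OpensMeasurableSpace X] {μ : Measure X}
    [IsFiniteMeasure μ] [μ.IsOpenPosMeasure] {h : X → ℝ} (hh : Integrable h μ)
    (H : ∀ g : C(X, ℝ), 0 ≤ g → 0 ≤ ∫ x, g x * h x ∂μ) {x : X} (hx : ContinuousAt h x) :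
    0 ≤ h x := by
  by_contra! hneg
  obtain ⟨δ, hδ, hball⟩ := Metric.mem_nhds_iff.1
    (hx.eventually_lt_const (show h x < h x / 2 by linarith))
  let g : C(X, ℝ) := ⟨fun y => max 0 (δ - dist y x), by fun_prop⟩
  have hg : 0 ≤ g := fun y => le_max_left _ _
  have hgpos : 0 < ∫ y, g y ∂μ :=
    g.continuous.integral_pos_of_hasCompactSupport_nonneg_nonzero
      (HasCompactSupport.of_compactSpace g) hg (x := x) (by simp [g, hδ])
  have hint {u : X → ℝ} (hu : Integrable u μ) : Integrable (fun y => g y * u y) μ :=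
    hu.bdd_mul g.continuous.aestronglyMeasurable (Eventually.of_forall g.norm_coe_le_norm)
  have hle : ∫ y, g y * h y ∂μ ≤ ∫ y, g y * (h x / 2) ∂μ := by
    refine integral_mono (hint hh) (hint (integrable_const _)) fun y => ?_
    rcases lt_or_ge (dist y x) δ with hy | hy
    · exact mul_le_mul_of_nonneg_left (hball hy : h y < h x / 2).le (hg y)
    · have hgy : g y = 0 := max_eq_left (sub_nonpos.2 hy)
      simp only [hgy, zero_mul, le_refl]
  rw [integral_mul_const] at hle
  linarith [H g hg, mul_neg_of_pos_of_neg hgpos (show h x / 2 < 0 by linarith)]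

theorem locallyIntegrable_of_tendsto_nhdsLT_nhdsGT {X E : Type*} [LinearOrder X]
    [TopologicalSpace X] [OrderClosedTopology X] [MeasurableSpace X] [OpensMeasurableSpace X]
    [NormedAddCommGroup E] {μ : Measure X} [IsLocallyFiniteMeasure μ] {h : X → E}
    (hm : AEStronglyMeasurable h μ) (hlt : ∀ x, ∃ l, Tendsto h (𝓝[<] x) (𝓝 l))
    (hgt : ∀ x, ∃ l, Tendsto h (𝓝[>] x) (𝓝 l)) : LocallyIntegrable h μ := by
  intro x
  obtain ⟨a, ha⟩ := hlt x
  obtain ⟨b, hb⟩ := hgt x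
  have hfin : μ.FiniteAtFilter (𝓝 x) := μ.finiteAt_nhds x
  have hpure : IntegrableAtFilter h (pure x) μ :=
    ⟨{x}, rfl, integrableOn_singleton (hx := isCompact_singleton.measure_lt_top)⟩
  have hleft := ha.integrableAtFilter hm.stronglyMeasurableAtFilter
    (hfin.filter_mono nhdsWithin_le_nhds)
  have hright := hb.integrableAtFilter hm.stronglyMeasurableAtFilter
    (hfin.filter_mono nhdsWithin_le_nhds)
  rw [← nhdsNE_sup_pure, ← nhdsLT_sup_nhdsGT, IntegrableAtFilter.sup_iff,
    IntegrableAtFilter.sup_iff]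
  exact ⟨⟨hleft, hright⟩, hpure⟩

theorem integrable_comp_coe_unitInterval {E : Type*} [NormedAddCommGroup E] {f : ℝ → E} :
    Integrable (fun x : I => f x) ↔ IntervalIntegrable f volume 0 1 := by
  rw [intervalIntegrable_iff_integrableOn_Icc_of_le zero_le_one]
  exact unitInterval.measurePreserving_coe.integrable_comp_emb unitInterval.measurableEmbedding_coe

theorem integral_unitInterval {E : Type*} [NormedAddCommGroup E] [NormedSpace ℝ E] (f : ℝ → E) :
    ∫ x : I, f x = ∫ x in (0 : ℝ)..1, f x := by
  rw [intervalIntegral.integral_of_le zero_le_one, ← integral_Icc_eq_integral_Ioc,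
    integral_subtype measurableSet_Icc]

theorem isOpenPosMeasure_volume_unitInterval : (volume : Measure I).IsOpenPosMeasure := by
  refine ⟨fun U hU hne hzero => ?_⟩
  obtain ⟨a, b, hab, hsub⟩ := hU.exists_Ioo_subset hne
  have h := measure_mono_null hsub hzero
  rw [unitInterval.volume_Ioo, ENNReal.ofReal_eq_zero, sub_nonpos] at h
  exact h.not_gt hab

theorem exists_contDiff_hasCompactSupport_eventuallyEq {E F : Type*} [NormedAddCommGroup E]
    [NormedSpace ℝ E] [FiniteDimensional ℝ E] [NormedAddCommGroup F] [NormedSpace ℝ F] {n : ℕ∞}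
    {K : Set E} (hK : Bornology.IsBounded K) {g : E → F} (hg : ContDiff ℝ n g) :
    ∃ φ : E → F, ContDiff ℝ n φ ∧ HasCompactSupport φ ∧ ∀ x ∈ K, φ =ᶠ[𝓝 x] g := by
  obtain ⟨r, hr, hKr⟩ := hK.subset_ball_lt 0 0
  let b : ContDiffBump (0 : E) := ⟨r, r + 1, hr, lt_add_one r⟩
  refine ⟨fun x => b x • g x, b.contDiff.smul hg, b.hasCompactSupport.smul_right, fun x hx => ?_⟩
  filter_upwards [b.eventuallyEq_one_of_mem_ball (hKr hx)] with y hy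
  rw [hy, Pi.one_apply, one_smul]

namespace PiecewiseContinuousOnUnit

variable {f : ℝ → ℝ}

theorem measurable (hf : PiecewiseContinuousOnUnit f) : Measurable fun x : I => f x := by
  refine measurable_of_countable_not_continuousAt ?_
  refine (hf.countable_discontinuities.preimage Subtype.val_injective).mono fun x hx => ?_
  exact ⟨x.2, fun h => hx ((continuousWithinAt_iff_continuousAt_domRestrict f x.2).1 h)⟩

theorem intervalIntegrable (hf : PiecewiseContinuousOnUnit f) :
    IntervalIntegrable f volume 0 1 := by
  have hcoe (x : I) (s : Set ℝ) : Tendsto ((↑) : I → ℝ) (𝓝[(↑) ⁻¹' s] x) (𝓝[s] x) :=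
    continuous_subtype_val.continuousWithinAt.tendsto_nhdsWithin (mapsTo_preimage _ _)
  have hloc : LocallyIntegrable fun x : I => f x := by
    refine locallyIntegrable_of_tendsto_nhdsLT_nhdsGT hf.measurable.aestronglyMeasurable
      (fun x => ?_) fun x => ?_
    · obtain rfl | hx := eq_or_ne x 0
      · exact ⟨0, by simp⟩
      · obtain ⟨l, hl⟩ := hf.left_limit x ⟨unitInterval.pos_iff_ne_zero.2 hx, x.2.2⟩
        exact ⟨l, hl.comp (hcoe x (Iio x))⟩
    · obtain rfl | hx := eq_or_ne x 1
      · have hempty : Ioi (1 : I) = ∅ := Ioi_top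
        exact ⟨0, by simp [hempty]⟩
      · obtain ⟨l, hl⟩ := hf.right_limit x ⟨x.2.1, unitInterval.lt_one_iff_ne_one.2 hx⟩
        exact ⟨l, hl.comp (hcoe x (Ioi x))⟩
  exact integrable_comp_coe_unitInterval.1
    (integrableOn_univ.1 (hloc.integrableOn_isCompact isCompact_univ))

theorem ae_continuousWithinAt (hf : PiecewiseContinuousOnUnit f) :
    ∀ᵐ x, x ∈ Icc (0 : ℝ) 1 → ContinuousWithinAt f (Icc 0 1) x := by
  filter_upwards [hf.countable_discontinuities.ae_notMem volume] with x hx hmem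
  exact not_not.1 fun h => hx ⟨hmem, h⟩

end PiecewiseContinuousOnUnit

theorem rieszFunctional_momentDeriv (s : ℕ → ℝ) (p : ℝ[X]) :
    rieszFunctional (momentDeriv s) p = -rieszFunctional s (derivative p) := by
  suffices h : rieszFunctional (momentDeriv s) = -(rieszFunctional s ∘ₗ derivative) by
    rw [h, LinearMap.neg_apply, LinearMap.comp_apply]
  refine (Polynomial.basisMonomials ℝ).ext fun i => ?_
  simp only [coe_basisMonomials, monomial_one_right_eq_X_pow, rieszFunctional_X_pow]
  rfl

theorem rieszFunctional_eq_integral {s : ℕ → ℝ} {f : ℝ → ℝ}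
    (hf : IntervalIntegrable f volume 0 1)
    (hs : ∀ i : ℕ, s i = ∫ x in (0 : ℝ)..1, x ^ i * f x) (p : ℝ[X]) :
    rieszFunctional s p = ∫ x : I, p.eval (x : ℝ) * f x := by
  rw [integral_unitInterval fun x => p.eval x * f x]
  have hint (q : ℝ[X]) : IntervalIntegrable (fun x => q.eval x * f x) volume 0 1 :=
    hf.continuousOn_mul q.continuous.continuousOn
  induction p using Polynomial.induction_on' with
  | add p q hp hq =>
    simp only [map_add, hp, hq, eval_add, add_mul]
    exact (intervalIntegral.integral_add (hint p) (hint q)).symm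
  | monomial n a =>
    rw [← C_mul_X_pow_eq_monomial, ← smul_eq_C_mul, map_smul, rieszFunctional_X_pow, hs]
    simp only [eval_smul, eval_pow, eval_X, smul_eq_mul, mul_assoc,
      intervalIntegral.integral_const_mul]

theorem DistribDerivIsSignedMeasure.exists_integral_derivative_mul {f : ℝ → ℝ}
    (hf : DistribDerivIsSignedMeasure f) :
    ∃ μ ν : FiniteMeasure I, ∀ p : ℝ[X],
      -∫ x : I, (derivative p).eval (x : ℝ) * f x =
        ∫ x : I, p.eval (x : ℝ) ∂(μ : Measure I) - ∫ x : I, p.eval (x : ℝ) ∂(ν : Measure I) := by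
  obtain ⟨μ, ν, hμ, hν, -, -, hμν⟩ := hf
  refine ⟨⟨μ, hμ⟩, ⟨ν, hν⟩, fun p => ?_⟩
  obtain ⟨φ, hφ, hφc, hφp⟩ := exists_contDiff_hasCompactSupport_eventuallyEq
    (Metric.isBounded_Icc (0 : ℝ) 1) (p.contDiff_aeval ∞)
  have hval (x : I) : φ x = p.eval (x : ℝ) := (hφp x x.2).eq_of_nhds
  have hderiv (x : I) : deriv φ x = (derivative p).eval (x : ℝ) :=
    (hφp x x.2).deriv_eq.trans p.deriv
  have h := hμν φ hφ hφc
  rw [← integral_unitInterval fun x => f x * deriv φ x] at h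
  simp only [hval, hderiv, mul_comm (f _)] at h
  rw [h, neg_neg]
  rfl

theorem IsRepresentingDensity.bddAbove_bernsteinVariation {s : ℕ → ℝ} {f : ℝ → ℝ}
    (hf : IsRepresentingDensity s f) : BddAbove (range (bernsteinVariation (rieszFunctional s))) :=
  have hint := hf.piecewise_continuous.intervalIntegrable
  bddAbove_bernsteinVariation_of_density (integrable_comp_coe_unitInterval.2 hint)
    (rieszFunctional_eq_integral hint hf.moment)

theorem IsRepresentingDensity.bddAbove_bernsteinVariation_momentDeriv {s : ℕ → ℝ} {f : ℝ → ℝ}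
    (hf : IsRepresentingDensity s f) :
    BddAbove (range (bernsteinVariation (rieszFunctional (momentDeriv s)))) := by
  obtain ⟨μ, ν, h⟩ := hf.deriv_measure.exists_integral_derivative_mul
  refine bddAbove_bernsteinVariation_iff.2 ⟨μ, ν, fun p => ?_⟩
  rw [← h, rieszFunctional_momentDeriv,
    rieszFunctional_eq_integral hf.piecewise_continuous.intervalIntegrable hf.moment]

theorem integral_measureReal_Iio_mul {X : Type*} [LinearOrder X] [TopologicalSpace X]
    [OrderClosedTopology X] [SecondCountableTopology X] [MeasurableSpace X]
    [OpensMeasurableSpace X] {μ ν : Measure X} [IsFiniteMeasure μ] [SFinite ν] {h : X → ℝ}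
    (hh : Integrable h ν) :
    ∫ x, μ.real (Iio x) * h x ∂ν = ∫ y, ∫ x in Ioi y, h x ∂ν ∂μ := by
  have hint : Integrable (Function.uncurry fun x y => (Iio x).indicator (fun _ => h x) y)
      (ν.prod μ) :=
    (hh.comp_fst μ).indicator (measurableSet_lt measurable_snd measurable_fst)
  calc _ = ∫ x, ∫ y, (Iio x).indicator (fun _ => h x) y ∂μ ∂ν := by
        simp only [integral_indicator_const _ measurableSet_Iio, smul_eq_mul]
    _ = ∫ y, ∫ x, (Ioi y).indicator h x ∂ν ∂μ := integral_integral_swap hint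
    _ = _ := by simp only [integral_indicator measurableSet_Ioi]

theorem setIntegral_Ioi_unitInterval {E : Type*} [NormedAddCommGroup E] [NormedSpace ℝ E]
    (f : ℝ → E) (y : I) : ∫ x in Ioi y, f x = ∫ x in (y : ℝ)..1, f x := by
  have hsub : Ioc (y : ℝ) 1 ⊆ I := fun x hx => ⟨y.2.1.trans hx.1.le, hx.2⟩
  rw [← unitInterval.measurePreserving_coe.setIntegral_image_emb
      unitInterval.measurableEmbedding_coe, image_subtype_val_Icc_Ioi,
    Measure.restrict_restrict measurableSet_Ioc, inter_eq_left.2 hsub,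
    intervalIntegral.integral_of_le y.2.2]

/-- The distribution function `x ↦ μ [0, x)` of a measure on the unit interval, in its
left-continuous version. -/
noncomputable def distFun (μ : Measure I) (x : ℝ) : ℝ :=
  μ.real {y | (y : ℝ) < x}

section DistFun

variable (μ ν : Measure I) [IsFiniteMeasure μ] [IsFiniteMeasure ν]

theorem monotone_distFun : Monotone (distFun μ) := fun _ _ hxy =>
  measureReal_mono fun _ hz => lt_of_lt_of_le hz hxy

theorem piecewiseContinuousOnUnit_distFun_sub :
    PiecewiseContinuousOnUnit (distFun μ - distFun ν) where
  right_limit x _ := ⟨_, ((monotone_distFun μ).tendsto_nhdsGT x).sub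
    ((monotone_distFun ν).tendsto_nhdsGT x)⟩
  left_limit x _ := ⟨_, ((monotone_distFun μ).tendsto_nhdsLT x).sub
    ((monotone_distFun ν).tendsto_nhdsLT x)⟩
  countable_discontinuities := by
    refine ((monotone_distFun μ).countable_not_continuousAt.union
      (monotone_distFun ν).countable_not_continuousAt).mono fun x hx => ?_
    by_contra h
    simp only [mem_union, mem_ofPred_eq, not_or, not_not] at h
    exact hx.2 (h.1.sub h.2).continuousWithinAt

theorem integral_distFun_mul_deriv {φ : ℝ → ℝ} (hφ : ContDiff ℝ 1 φ) :
    ∫ x in (0 : ℝ)..1, distFun μ x * deriv φ x = μ.real univ * φ 1 - ∫ x : I, φ x ∂μ := by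
  have hc : Continuous (deriv φ) := hφ.continuous_deriv le_rfl
  have hint : Integrable (fun x : I => φ x) μ :=
    (hφ.continuous.comp continuous_subtype_val).integrable_of_hasCompactSupport
      (HasCompactSupport.of_compactSpace _)
  calc _ = ∫ x : I, μ.real (Iio x) * deriv φ x :=
        (integral_unitInterval fun x => distFun μ x * deriv φ x).symm
    _ = ∫ y, (∫ x : I in Ioi y, deriv φ x) ∂μ := integral_measureReal_Iio_mul
        (integrable_comp_coe_unitInterval.2 (hc.intervalIntegrable 0 1))
    _ = ∫ y : I, (φ 1 - φ y) ∂μ := by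
        refine integral_congr_ae (Eventually.of_forall fun y => ?_)
        exact (setIntegral_Ioi_unitInterval (deriv φ) y).trans
          (intervalIntegral.integral_deriv_eq_sub' φ rfl
            (fun x _ => hφ.differentiable one_ne_zero x) hc.continuousOn)
    _ = _ := by
        rw [integral_sub (integrable_const _) hint, integral_const, smul_eq_mul]

variable {μ ν} in
theorem integral_distFun_sub_mul_deriv (hμν : μ.real univ = ν.real univ) {φ : ℝ → ℝ}
    (hφ : ContDiff ℝ 1 φ) :
    ∫ x in (0 : ℝ)..1, (distFun μ - distFun ν) x * deriv φ x =
      -(∫ x : I, φ x ∂μ - ∫ x : I, φ x ∂ν) := by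
  have hint (ρ : Measure I) [IsFiniteMeasure ρ] :
      IntervalIntegrable (fun x => distFun ρ x * deriv φ x) volume 0 1 :=
    (monotone_distFun ρ).intervalIntegrable.mul_continuousOn
      (hφ.continuous_deriv le_rfl).continuousOn
  simp only [Pi.sub_apply, sub_mul]
  rw [intervalIntegral.integral_sub (hint μ) (hint ν), integral_distFun_mul_deriv μ hφ,
    integral_distFun_mul_deriv ν hφ, hμν, sub_sub_sub_cancel_left, neg_sub]

end DistFun

theorem exists_isRepresentingDensity {s : ℕ → ℝ}
    (hs : BddAbove (range (bernsteinVariation (rieszFunctional (momentDeriv s))))) :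
    ∃ f : ℝ → ℝ, IsRepresentingDensity s f := by
  obtain ⟨μ, ν, h⟩ := bddAbove_bernsteinVariation_iff.1 hs
  have hpow (i : ℕ) : momentDeriv s i =
      ∫ x : I, (x : ℝ) ^ i ∂(μ : Measure I) - ∫ x : I, (x : ℝ) ^ i ∂(ν : Measure I) := by
    simpa only [rieszFunctional_X_pow, eval_pow, eval_X] using h (X ^ i)
  have hmass : (μ : Measure I).real univ = (ν : Measure I).real univ := by
    have h0 := hpow 0
    simp only [momentDeriv_zero, pow_zero, integral_const, smul_eq_mul, mul_one] at h0
    exact sub_eq_zero.1 h0.symm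
  refine ⟨distFun μ - distFun ν, piecewiseContinuousOnUnit_distFun_sub _ _, fun i => ?_,
    μ, ν, inferInstance, inferInstance, inferInstance, inferInstance,
    fun φ hφ _ => integral_distFun_sub_mul_deriv hmass (hφ.of_le (by exact_mod_cast le_top))⟩
  have hi := integral_distFun_sub_mul_deriv hmass (φ := fun x => x ^ (i + 1)) (by fun_prop)
  rw [← hpow, momentDeriv_succ, neg_neg] at hi
  refine mul_left_cancel₀ (Nat.cast_add_one_ne_zero (R := ℝ) i) (hi.symm.trans ?_)
  rw [← intervalIntegral.integral_const_mul]
  refine intervalIntegral.integral_congr fun x _ => ?_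
  simp only [deriv_pow_field, Nat.add_sub_cancel, Nat.cast_add, Nat.cast_one]
  ring

theorem nonneg_of_continuousWithinAt_of_rieszFunctional_nonneg {s : ℕ → ℝ} {f : ℝ → ℝ}
    (hf : IntervalIntegrable f volume 0 1)
    (hs : ∀ i : ℕ, s i = ∫ x in (0 : ℝ)..1, x ^ i * f x)
    (hpos : ∀ k l : ℕ, 0 ≤ rieszFunctional s (X ^ k * (1 - X) ^ l)) {x : ℝ}
    (hx : x ∈ Icc (0 : ℝ) 1) (hc : ContinuousWithinAt f (Icc 0 1) x) : 0 ≤ f x := by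
  have hint := integrable_comp_coe_unitInterval.2 hf
  have := isOpenPosMeasure_volume_unitInterval
  exact nonneg_of_continuousAt_of_integral_mul_nonneg hint
    (fun g => integral_mul_nonneg_of_map_nonneg hint (rieszFunctional_eq_integral hf hs) hpos)
    ((continuousWithinAt_iff_continuousAt_domRestrict f hx).1 hc)

theorem PiecewiseContinuousOnUnit.continuous_comp {f g : ℝ → ℝ} (hg : Continuous g)
    (hf : PiecewiseContinuousOnUnit f) : PiecewiseContinuousOnUnit fun x => g (f x) where
  right_limit x hx :=
    let ⟨l, hl⟩ := hf.right_limit x hx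
    ⟨g l, (hg.tendsto l).comp hl⟩
  left_limit x hx :=
    let ⟨l, hl⟩ := hf.left_limit x hx
    ⟨g l, (hg.tendsto l).comp hl⟩
  countable_discontinuities := by
    refine hf.countable_discontinuities.mono fun x hx => ?_
    exact ⟨hx.1, fun h => hx.2 (hg.continuousAt.comp_continuousWithinAt h)⟩

theorem IsRepresentingDensity.congr_ae {s : ℕ → ℝ} {f g : ℝ → ℝ} (hf : IsRepresentingDensity s f)
    (hg : PiecewiseContinuousOnUnit g) (hfg : ∀ᵐ x, x ∈ Icc (0 : ℝ) 1 → f x = g x) :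
    IsRepresentingDensity s g := by
  have hcongr (u v : ℝ → ℝ) : ∫ x in (0 : ℝ)..1, u x * f x * v x =
      ∫ x in (0 : ℝ)..1, u x * g x * v x := by
    refine intervalIntegral.integral_congr_ae (hfg.mono fun x hx hmem => ?_)
    rw [uIoc_of_le zero_le_one] at hmem
    rw [hx (Ioc_subset_Icc_self hmem)]
  obtain ⟨μ, ν, hμ, hν, hμr, hνr, h⟩ := hf.deriv_measure
  refine ⟨hg, fun i => ?_, μ, ν, hμ, hν, hμr, hνr, fun φ hφ hφc => ?_⟩
  · simpa only [mul_one] using (hf.moment i).trans (by simpa using hcongr (· ^ i) 1)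
  · rw [← h φ hφ hφc]
    simpa only [Pi.one_apply, one_mul] using (hcongr 1 (deriv φ)).symm

theorem IsRepresentingDensity.max_zero {s : ℕ → ℝ} {f : ℝ → ℝ} (hf : IsRepresentingDensity s f)
    (hpos : ∀ k l : ℕ, 0 ≤ rieszFunctional s (X ^ k * (1 - X) ^ l)) :
    IsRepresentingDensity s fun x => max (f x) 0 := by
  refine hf.congr_ae (hf.piecewise_continuous.continuous_comp (g := (max · 0)) (by fun_prop)) ?_
  filter_upwards [hf.piecewise_continuous.ae_continuousWithinAt] with x hx hmem
  exact (max_eq_left (nonneg_of_continuousWithinAt_of_rieszFunctional_nonneg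
    hf.piecewise_continuous.intervalIntegrable hf.moment hpos hmem (hx hmem))).symm

theorem exists_pos_forall_lt_and_lt_iff {ι : Type*} {u v : ι → ℝ} :
    (∃ C, 0 < C ∧ ∀ i, u i < C ∧ v i < C) ↔ BddAbove (range u) ∧ BddAbove (range v) := by
  refine ⟨fun ⟨C, _, hC⟩ => ⟨⟨C, forall_mem_range.2 fun i => (hC i).1.le⟩,
    ⟨C, forall_mem_range.2 fun i => (hC i).2.le⟩⟩, fun ⟨⟨A, hA⟩, ⟨B, hB⟩⟩ => ?_⟩
  refine ⟨max 0 (max A B) + 1, by positivity, fun i => ⟨?_, ?_⟩⟩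
  · exact lt_add_of_le_of_pos
      ((hA (mem_range_self i)).trans ((le_max_left A B).trans (le_max_right _ _))) one_pos
  · exact lt_add_of_le_of_pos
      ((hB (mem_range_self i)).trans ((le_max_right A B).trans (le_max_right _ _))) one_pos

theorem theorem3p1_general (s : ℕ → ℝ) :
    List.TFAE [
      ∃ f : ℝ → ℝ, IsRepresentingDensity s f,
      ∃ C : ℝ, 0 < C ∧ ∀ d : ℕ,
        ∑ k ∈ Finset.range (d + 1),
          (d.choose k : ℝ) * |rieszFunctional s (X ^ k * (1 - X) ^ (d - k))| < C ∧
        ∑ k ∈ Finset.range (d + 1),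
          (d.choose k : ℝ) * |rieszFunctional (momentDeriv s) (X ^ k * (1 - X) ^ (d - k))| < C,
      BddAbove (range (bernsteinVariation (rieszFunctional (momentDeriv s))))] ∧
    ((∀ k l : ℕ, 0 ≤ rieszFunctional s (X ^ k * (1 - X) ^ l)) →
      (∀ f : ℝ → ℝ, IntervalIntegrable f volume 0 1 →
        (∀ i : ℕ, s i = ∫ x in (0 : ℝ)..1, x ^ i * f x) →
        ∀ x ∈ Icc (0 : ℝ) 1, ContinuousWithinAt f (Icc 0 1) x → 0 ≤ f x) ∧
      ∀ f : ℝ → ℝ, IsRepresentingDensity s f → IsRepresentingDensity s fun x => max (f x) 0) := by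
  simp only [← bernsteinVariation_eq, exists_pos_forall_lt_and_lt_iff]
  refine ⟨?_, fun hpos => ⟨fun f hf hs x hx hc =>
    nonneg_of_continuousWithinAt_of_rieszFunctional_nonneg hf hs hpos hx hc,
    fun f hf => hf.max_zero hpos⟩⟩
  tfae_have 1 → 2 := fun ⟨f, hf⟩ =>
    ⟨hf.bddAbove_bernsteinVariation, hf.bddAbove_bernsteinVariation_momentDeriv⟩
  tfae_have 2 → 3 := And.right
  tfae_have 3 → 1 := exists_isRepresentingDensity
  tfae_finish

theorem theorem3p1 (s : ℕ → ℝ) :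
    ((∃ f : ℝ → ℝ, IsRepresentingDensity s f) ↔
      ∃ C : ℝ, 0 < C ∧ ∀ d : ℕ,
        ∑ k ∈ Finset.range (d + 1),
          (d.choose k : ℝ) * |rieszFunctional s (X ^ k * (1 - X) ^ (d - k))| < C ∧
        ∑ k ∈ Finset.range (d + 1),
          (d.choose k : ℝ) * |rieszFunctional (momentDeriv s) (X ^ k * (1 - X) ^ (d - k))| < C) ∧
    ((∀ k l : ℕ, 0 ≤ rieszFunctional s (X ^ k * (1 - X) ^ l)) →
      (∀ f : ℝ → ℝ, IsRepresentingDensity s f →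
        ∀ x ∈ Icc (0 : ℝ) 1, ContinuousWithinAt f (Icc 0 1) x → 0 ≤ f x) ∧
      ((∃ f : ℝ → ℝ, IsRepresentingDensity s f) →
        ∃ f : ℝ → ℝ, IsRepresentingDensity s f ∧ ∀ x ∈ Icc (0 : ℝ) 1, 0 ≤ f x)) := by
  refine ⟨(theorem3p1_general s).1.out 0 1, fun hpos => ?_⟩
  obtain ⟨hcont, hmax⟩ := (theorem3p1_general s).2 hpos
  exact ⟨fun f hf => hcont f hf.piecewise_continuous.intervalIntegrable hf.moment,
    fun ⟨f, hf⟩ => ⟨_, hmax f hf, fun _ _ => le_max_right _ _⟩⟩
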